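/- Let $R=\mathbb C[x_0,\dots,x_n]=\bigoplus_t R_t$, with $R_t=0$ for $t<0$ and $r_t=\dim_{\mathbb C}R_t$. Let $I=(F_1,\dots,F_r)\subset R$ be an artinian ideal generated by $r$ forms of degree $d$, put $A=R/I$, and write $I_t=I\cap R_t$ and $A_t=R_t/I_t$. Let $i\ge 0$, $k\ge 1$ be integers, and assume that there is no syzygy of degree $i$ among the $F_j$, i.e. $\sum_j G_jF_j=0$ with all $G_j\in R_i$ implies $G_1=\dots=G_r=0$. Put $$N=r(r_i-r_{i-k})-(r_{d+i}-r_{d+i-k}),\qquad N^+=\max(0,N),\qquad N^-=\max(0,-N).$$ For a positive integer $\delta$ consider the following conditions. * $(2)_\delta$ For a general linear form $L$ there are $N^++\delta$ vectors $(G_{1l},\dots,G_{rl})\in R_i^{\oplus r}$, linearly independent modulo $L^k$ (that is, in $(R/L^kR)^{\oplus r}$; if $i<k$ this is just linear independence), and forms $G_l\in R_{d+i-k}$, such that $G_{1l}F_1+\dots+G_{rl}F_r=L^kG_l$ for $l=1,\dots,N^++\delta$. * $(3)_\delta$ The projection of the Veronese variety $v_{d+i}(\mathbb P^n)$ from $I_{d+i}$,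 i.e. the variety parametrized by $[L]\mapsto[L^{d+i}\bmod I_{d+i}]\in\mathbb P(A_{d+i})$ (lines in $A_{d+i}$), satisfies exactly $\delta$ non-trivial Laplace equations of order $s=d+i-k$: the span of the partial derivatives of order at most $s$ of this parametrization at a general point (its $s$-th osculating space) has projective dimension $$\inf\Bigl(\tbinom{n+s}{n}-\dim I_s-1,\ \dim A_{d+i}-1\Bigr)-\delta .$$ (The $\dim I_s$ relations among the derivatives given by the forms of $I_s$ are trivial and are not counted. If $i<k$ then $I_s=0$, and this is the usual definition, with expected dimension $\inf(\binom{n+s}{n}-1,\dim A_{d+i}-1)$; if $s<0$ there are no derivatives and $\binom{n+s}{n}$ is read as $0$.) * $(4)_\delta$ For every nonzero $L=\sum a_jx_j\in R_1$, the forms of degree $d+i$ on the dual projective space that are apolar to $I_{d+i}$ (the space $(I_{d+i}^\perp)^*$: all $f$ of degree $d+i$ with $F(\partial)f=0$ for every $F\in I_{d+i}$) and have multiplicity at least $d+i-k+1$ at the point $L^\vee=[a_0:\dots:a_n]$ form a vector space of dimension at least $N^-+\delta$. Then the following are equivalent: 1. $I$ fails the SLP at range $k$ in degree $d+i-k$,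 i.e. for every linear form $L$ the multiplication map $\times L^k:A_{d+i-k}\to A_{d+i}$ is neither injective nor surjective; 2. $(2)_\delta$ holds for some $\delta\ge1$; 3. $(3)_\delta$ holds for some $\delta\ge1$; 4. $(4)_\delta$ holds for some $\delta\ge1$. Moreover, for each fixed $\delta\ge 1$, the conditions $(2)_\delta$, $(4)_\delta$ and "$(3)_{\delta'}$ holds for some $\delta'\ge\delta$" are equivalent. If $i<k$, condition $(3)_\delta$ coincides, for every integer $\delta\ge0$, with the usual definition of satisfying $\delta$ Laplace equations of order $d+i-k$. -/

import Mathlib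

open MvPolynomial

noncomputable section

/-- The space `R_t` of forms of degree `t` in `R = ℂ[x_0, …, x_n]`, for an integer `t`;
it is zero for `t < 0`. -/
def forms (n : ℕ) (t : ℤ) : Submodule ℂ (MvPolynomial (Fin (n + 1)) ℂ) :=
  match t with
  | Int.ofNat m => homogeneousSubmodule (Fin (n + 1)) ℂ m
  | Int.negSucc _ => ⊥

/-- `r_t = dim R_t`. -/
def dimForms (n : ℕ) (t : ℤ) : ℕ := Module.finrank ℂ (forms n t)

/-- `N(r,i,k,d) = r (r_i - r_{i-k}) - (r_{d+i} - r_{d+i-k})`. -/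
def numN (n r i k d : ℕ) : ℤ :=
  (r : ℤ) * ((dimForms n i : ℤ) - (dimForms n ((i : ℤ) - k) : ℤ))
    - ((dimForms n ((d : ℤ) + i) : ℤ) - (dimForms n ((d : ℤ) + i - k) : ℤ))

/-- `N⁺ = sup (0, N)`. -/
def numNPlus (n r i k d : ℕ) : ℕ := (numN n r i k d).toNat

/-- `N⁻ = sup (0, -N)`. -/
def numNMinus (n r i k d : ℕ) : ℕ := (-numN n r i k d).toNat

/-- The linear form `a_0 x_0 + ⋯ + a_n x_n`. -/
def linForm {n : ℕ} (a : Fin (n + 1) → ℂ) : MvPolynomial (Fin (n + 1)) ℂ :=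
  ∑ j, C (a j) * X j

/-- `P` holds at a general point of `ℂ^m`: on a non-empty Zariski open subset, which may
be taken to be the complement of a hypersurface. -/
def ForGeneral {m : ℕ} (P : (Fin m → ℂ) → Prop) : Prop :=
  ∃ Q : MvPolynomial (Fin m) ℂ, Q ≠ 0 ∧ ∀ a, eval a Q ≠ 0 → P a

/-- `I_t = I ∩ R_t`. -/
def idealPiece {n : ℕ} (I : Ideal (MvPolynomial (Fin (n + 1)) ℂ)) (t : ℤ) :
    Submodule ℂ (MvPolynomial (Fin (n + 1)) ℂ) :=
  I.restrictScalars ℂ ⊓ forms n t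

/-- The graded piece `A_t` of `A = R / I`: the image of `R_t` in `A`. -/
def quotPiece {n : ℕ} (I : Ideal (MvPolynomial (Fin (n + 1)) ℂ)) (t : ℤ) :
    Submodule ℂ (MvPolynomial (Fin (n + 1)) ℂ ⧸ I) :=
  (forms n t).map (Ideal.Quotient.mkₐ ℂ I).toLinearMap

/-- Multiplication by `L ^ k` from `A_e` to `A_{e+k}` has maximal rank. -/
def HasMaximalRank {n : ℕ} (I : Ideal (MvPolynomial (Fin (n + 1)) ℂ))
    (L : MvPolynomial (Fin (n + 1)) ℂ) (k : ℕ) (e : ℤ) : Prop :=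
  Set.InjOn (fun x => Ideal.Quotient.mk I L ^ k * x) (quotPiece I e) ∨
    Set.SurjOn (fun x => Ideal.Quotient.mk I L ^ k * x) (quotPiece I e) (quotPiece I (e + k))

/-- `I` fails the strong Lefschetz property at range `k` in degree `e`. -/
def FailsSLPAt {n : ℕ} (I : Ideal (MvPolynomial (Fin (n + 1)) ℂ)) (k : ℕ) (e : ℤ) : Prop :=
  ∀ L ∈ forms n 1, ¬ HasMaximalRank I L k e

/-- There is no syzygy of degree `i` among the `F_j`. -/
def NoSyzygy {n r : ℕ} (F : Fin r → MvPolynomial (Fin (n + 1)) ℂ) (i : ℕ) : Prop :=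
  ∀ G : Fin r → MvPolynomial (Fin (n + 1)) ℂ,
    (∀ j, G j ∈ forms n i) → ∑ j, G j * F j = 0 → G = 0

/-- For a general linear form `L` there are `c` vectors `(G_{1l}, …, G_{rl})` of forms of
degree `i`, linearly independent modulo `L ^ k`, and `c` forms `H_l` of degree `d + i - k`, with
`G_{1l} F_1 + ⋯ + G_{rl} F_r = L ^ k H_l`. -/
def HasRelations {n r : ℕ} (F : Fin r → MvPolynomial (Fin (n + 1)) ℂ) (d i k c : ℕ) : Prop :=
  ForGeneral fun a : Fin (n + 1) → ℂ =>
    ∃ (G : Fin c → Fin r → MvPolynomial (Fin (n + 1)) ℂ)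
      (H : Fin c → MvPolynomial (Fin (n + 1)) ℂ),
      (∀ l j, G l j ∈ forms n i) ∧
      (∀ l, H l ∈ forms n ((d : ℤ) + i - k)) ∧
      LinearIndependent ℂ
        (fun l j => Ideal.Quotient.mk (Ideal.span {linForm a ^ k}) (G l j)) ∧
      ∀ l, ∑ j, G l j * F j = linForm a ^ k * H l

/-- The iterated partial derivative `∂^α`. -/
def partialDeriv {A : Type*} [CommRing A] {m : ℕ} (α : Fin m →₀ ℕ) :
    Module.End A (MvPolynomial (Fin m) A) :=
  ((List.finRange m).map fun j =>
    ((pderiv j).toLinearMap : Module.End A (MvPolynomial (Fin m) A)) ^ α j).prod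

/-- For a polynomial map `φ` from `ℂ^n` to the vector space `A`, parametrizing a variety in the
projective space of lines of `A`: the linear span of the partial derivatives of order at most `s`
of `φ` at `y`, the cone over the `s`-th osculating space at the point `[φ y]`. -/
def osculatingSpace {A : Type*} [CommRing A] [Algebra ℂ A] {n : ℕ}
    (φ : MvPolynomial (Fin n) A) (s : ℤ) (y : Fin n → ℂ) : Submodule ℂ A :=
  Submodule.span ℂ
    {v | ∃ α : Fin n →₀ ℕ, ((α.degree : ℕ) : ℤ) ≤ s ∧
      v = eval (fun j => algebraMap ℂ A (y j)) (partialDeriv α φ)}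

/-- The number of partial derivatives of order at most `s` in `n` variables: `(n + s choose n)`
for `s ≥ 0`, and `0` for `s < 0`. -/
def numDerivs (n : ℕ) (s : ℤ) : ℕ :=
  match s with
  | Int.ofNat m => (n + m).choose n
  | Int.negSucc _ => 0

/-- The variety parametrized by `φ` in the projective space of lines of `V` satisfies `δ` Laplace
equations of order `s`, where `τ` relations between the derivatives are discounted as trivial: its
`s`-th osculating space at a general point has projective dimension
`inf ((n + s choose n) - τ - 1, dim V - 1) - δ`. -/
def SatisfiesLaplaceModulo {A : Type*} [CommRing A] [Algebra ℂ A] {n : ℕ}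
    (V : Submodule ℂ A) (φ : MvPolynomial (Fin n) A) (s : ℤ) (τ δ : ℕ) : Prop :=
  ForGeneral fun y : Fin n → ℂ =>
    (Module.finrank ℂ (osculatingSpace φ s y) : ℤ) - 1 =
      min ((numDerivs n s : ℤ) - τ - 1) ((Module.finrank ℂ V : ℤ) - 1) - δ

/-- The variety parametrized by `φ` in the projective space of lines of `V` satisfies `δ` Laplace
equations of order `s`: its `s`-th osculating space at a general point has projective dimension
`inf ((n + s choose n) - 1, dim V - 1) - δ`. -/
def SatisfiesLaplace {A : Type*} [CommRing A] [Algebra ℂ A] {n : ℕ}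
    (V : Submodule ℂ A) (φ : MvPolynomial (Fin n) A) (s : ℤ) (δ : ℕ) : Prop :=
  SatisfiesLaplaceModulo V φ s 0 δ

/-- The Veronese variety `[L] ↦ [L ^ t]` in the chart `L = x_0 + y_1 x_1 + ⋯ + y_n x_n`, as a
polynomial in the parameters `y` with coefficients in `R`. -/
def veroneseParam (n t : ℕ) : MvPolynomial (Fin n) (MvPolynomial (Fin (n + 1)) ℂ) :=
  (C (X 0) + ∑ j : Fin n, C (X j.succ) * X j) ^ t

/-- The projection of the Veronese variety from `I_t`: `[L] ↦ [L ^ t mod I]`, with values in the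
projective space of lines of `R_t / I_t = A_t`. -/
def projVeroneseParam {n : ℕ} (I : Ideal (MvPolynomial (Fin (n + 1)) ℂ)) (t : ℕ) :
    MvPolynomial (Fin n) (MvPolynomial (Fin (n + 1)) ℂ ⧸ I) :=
  MvPolynomial.map (Ideal.Quotient.mk I) (veroneseParam n t)

/-- `F(∂) f`, the apolarity action. -/
def diffOp {n : ℕ} (F f : MvPolynomial (Fin (n + 1)) ℂ) : MvPolynomial (Fin (n + 1)) ℂ :=
  ∑ α ∈ F.support, coeff α F • partialDeriv α f

/-- The forms of degree `t` on the dual projective space that are apolar to `I_t`: this is the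
space `(I_t^⊥)^*`. -/
def apolarForms {n : ℕ} (I : Ideal (MvPolynomial (Fin (n + 1)) ℂ)) (t : ℤ) :
    Submodule ℂ (MvPolynomial (Fin (n + 1)) ℂ) where
  carrier := {f | f ∈ forms n t ∧ ∀ F ∈ idealPiece I t, diffOp F f = 0}
  zero_mem' := ⟨Submodule.zero_mem _, fun F _ => by simp [diffOp]⟩
  add_mem' := fun hf hg => ⟨Submodule.add_mem _ hf.1 hg.1, fun F hF => by
    have h1 := hf.2 F hF
    have h2 := hg.2 F hF
    simp only [diffOp, map_add, smul_add, Finset.sum_add_distrib] at h1 h2 ⊢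
    rw [h1, h2, add_zero]⟩
  smul_mem' := fun c f hf => ⟨Submodule.smul_mem _ c hf.1, fun F hF => by
    have h1 := hf.2 F hF
    simp only [diffOp, map_smul, smul_comm _ c, ← Finset.smul_sum] at h1 ⊢
    rw [h1, smul_zero]⟩

/-- The polynomials having multiplicity at least `μ` at the point `a`: all partial derivatives of
order less than `μ` vanish there. -/
def multiplicityAtLeast {n : ℕ} (μ : ℤ) (a : Fin (n + 1) → ℂ) :
    Submodule ℂ (MvPolynomial (Fin (n + 1)) ℂ) where
  carrier := {f | ∀ α : Fin (n + 1) →₀ ℕ, ((α.degree : ℕ) : ℤ) < μ →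
    eval a (partialDeriv α f) = 0}
  zero_mem' := fun α _ => by simp
  add_mem' := fun hf hg α hα => by simp [hf α hα, hg α hα]
  smul_mem' := fun c f hf α hα => by simp [hf α hα]

/-- For every nonzero linear form `L = a_0 x_0 + ⋯ + a_n x_n`, the forms in `(I_{d+i}^⊥)^*` with
multiplicity at least `d + i - k + 1` at the point `L^∨ = [a]` of the dual projective space form a
vector space of dimension at least `c`. -/
def HasSingularForms {n : ℕ} (I : Ideal (MvPolynomial (Fin (n + 1)) ℂ)) (d i k c : ℕ) : Prop :=
  ∀ a : Fin (n + 1) → ℂ, a ≠ 0 →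
    c ≤ Module.finrank ℂ
      ↥(apolarForms I ((d : ℤ) + i) ⊓ multiplicityAtLeast ((d : ℤ) + i - k + 1) a)

/-- The projection of the Veronese variety `v_{d+i}(ℙ^n)` from `I_{d+i}` satisfies `δ` Laplace
equations of order `d + i - k`. The relations given by the forms `G` in `I_{d+i-k}` are trivial and
are not counted: the derivative of `L ^ (d+i)` along `G` is a multiple of `L ^ k G`, which the
projection kills. They exist only if `i ≥ k`. -/
def ProjectionSatisfiesLaplace {n : ℕ} (I : Ideal (MvPolynomial (Fin (n + 1)) ℂ))
    (d i k δ : ℕ) : Prop :=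
  SatisfiesLaplaceModulo (quotPiece I ((d : ℤ) + i)) (projVeroneseParam I (d + i))
    ((d : ℤ) + i - k) (Module.finrank ℂ (idealPiece I ((d : ℤ) + i - k))) δ

end

/-!
Put `s = d + i - k`. Each of the conditions measures the rank of `×L ^ k : A_s → A_{s+k}`. By lower
semicontinuity this rank takes its largest value at a general `L`, and `I` fails the SLP exactly
when that value is smaller than `min (dim A_s) (dim A_{s+k})`; the number `δ` is the difference.

* As there is no syzygy of degree `i`, there is none of degree `i - k`, so `dim I_{d+i} = r r_i` and
  `dim I_s = r r_{i-k}`. Hence `N = dim A_s - dim A_{s+k}`, and `(G_j) ↦ ∑ G_j F_j / L ^ k`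
  identifies the relations modulo `L ^ k`, taken up to multiples of `L ^ k`, with the kernel of
  `×L ^ k`.
* The derivatives of order `e ≤ s` of `L ↦ L ^ (d+i)` are nonzero multiples of the `L ^ (d+i-e) M`
  for monomials `M` of degree `e`. Together they span `L ^ k R_s`, so the osculating space of the
  projected Veronese variety is the image of `×L ^ k`.
* For the apolarity pairing, the forms with multiplicity at least `s + 1` at `L^∨` are the
  orthogonal of `L ^ k R_s`. Those that are also apolar to `I_{d+i}` are therefore dual to the
  cokernel of `×L ^ k`.
-/

/-! ### Linear algebra -/

section LinearAlgebra

variable {K V W ι : Type*} [Field K] [AddCommGroup V] [Module K V] [AddCommGroup W] [Module K W]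

lemma finrank_map_add_finrank_inf_ker (f : V →ₗ[K] W) (S : Submodule K V) [FiniteDimensional K S] :
    Module.finrank K (S.map f) + Module.finrank K ↥(S ⊓ LinearMap.ker f) = Module.finrank K S := by
  rw [← LinearMap.finrank_range_add_finrank_ker (f.domRestrict S), LinearMap.range_domRestrict,
    LinearMap.ker_domRestrict, ← Submodule.map_comap_subtype,
    (Submodule.equivMapOfInjective S.subtype S.injective_subtype _).finrank_eq]

lemma finrank_map_of_disjoint_ker {f : V →ₗ[K] W} {S : Submodule K V} [FiniteDimensional K S]
    (h : Disjoint S (LinearMap.ker f)) : Module.finrank K (S.map f) = Module.finrank K S := by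
  rw [← finrank_map_add_finrank_inf_ker f S, h.eq_bot, finrank_bot, add_zero]

lemma card_le_finrank_range_of_det_ne_zero [FiniteDimensional K V] [Fintype ι] [DecidableEq ι]
    (f : V →ₗ[K] W) (v : ι → V) (g : W →ₗ[K] ι → K)
    (h : (Matrix.of fun i => g (f (v i))).det ≠ 0) :
    Fintype.card ι ≤ Module.finrank K (LinearMap.range f) := by
  have hgf : LinearIndependent K fun i => g (f (v i)) :=
    Matrix.linearIndependent_rows_of_det_ne_zero h
  have hf : LinearIndependent K fun i => f.rangeRestrict (v i) :=
    LinearIndependent.of_comp (LinearMap.range f).subtype (hgf.of_comp g)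
  exact hf.fintype_card_le_finrank

lemma exists_matrix_eq_one_of_finrank_range [FiniteDimensional K V] (f : V →ₗ[K] W) :
    ∃ (v : Fin (Module.finrank K (LinearMap.range f)) → V)
      (g : W →ₗ[K] Fin (Module.finrank K (LinearMap.range f)) → K),
      (Matrix.of fun i => g (f (v i))) = 1 := by
  let b := Module.finBasis K (LinearMap.range f)
  choose v hv using fun i => (b i).2
  obtain ⟨g, hg⟩ := LinearMap.exists_extend (b.equivFun.toLinearMap)
  refine ⟨v, g, Matrix.ext fun i j => ?_⟩
  have hgb : g (b i : W) = b.equivFun (b i) := LinearMap.congr_fun hg (b i)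
  simp [hv, hgb, Matrix.one_apply]

lemma exists_polynomial_finrank_range_le {σ : Type*} [FiniteDimensional K V]
    (T : (σ → K) → V →ₗ[K] W)
    (hT : ∀ (φ : Module.Dual K W) (v : V), ∃ p : MvPolynomial σ K, ∀ a, eval a p = φ (T a v))
    (a₀ : σ → K) :
    ∃ q : MvPolynomial σ K, eval a₀ q ≠ 0 ∧ ∀ a, eval a q ≠ 0 →
      Module.finrank K (LinearMap.range (T a₀)) ≤ Module.finrank K (LinearMap.range (T a)) := by
  obtain ⟨v, g, hvg⟩ := exists_matrix_eq_one_of_finrank_range (T a₀)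
  choose p hp using fun i j => hT (LinearMap.proj j ∘ₗ g) (v i)
  have heval (a : σ → K) :
      eval a (Matrix.of p).det = (Matrix.of fun i => g (T a (v i))).det := by
    rw [RingHom.map_det]
    congr 1
    ext i j
    exact hp i j a
  refine ⟨(Matrix.of p).det, ?_, fun a ha => ?_⟩
  · rw [heval, hvg, Matrix.det_one]
    exact one_ne_zero
  · rw [heval] at ha
    simpa using card_le_finrank_range_of_det_ne_zero (T a) v g ha

lemma finrank_pi_univ [Fintype ι] (S : Submodule K V) [FiniteDimensional K S] :
    Module.finrank K (Submodule.pi Set.univ fun _ : ι => S) =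
      Fintype.card ι * Module.finrank K S := by
  have hrange : Submodule.pi Set.univ (fun _ : ι => S) =
      LinearMap.range (S.subtype.compLeft ι) := by
    rw [LinearMap.range_compLeft, Submodule.range_subtype]
  rw [hrange, LinearMap.finrank_range_of_inj S.injective_subtype.comp_left,
    Module.finrank_pi_fintype, Finset.sum_const, Finset.card_univ, smul_eq_mul]

lemma sup_orthogonalBilin (B : V →ₗ[K] V →ₗ[K] K) (S T : Submodule K V) :
    (S ⊔ T).orthogonalBilin B = S.orthogonalBilin B ⊓ T.orthogonalBilin B := by
  refine le_antisymm (le_inf (Submodule.orthogonalBilin_le le_sup_left)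
    (Submodule.orthogonalBilin_le le_sup_right)) ?_
  rintro f ⟨hS, hT⟩ F hF
  obtain ⟨P, hP, Q, hQ, rfl⟩ := Submodule.mem_sup.1 hF
  rw [map_add, LinearMap.add_apply, hS P hP, hT Q hQ, add_zero]

lemma finrank_inf_orthogonalBilin_add_finrank {B : V →ₗ[K] V →ₗ[K] K} {H W : Submodule K V}
    [FiniteDimensional K H] (hB : (B.domRestrict₁₂ H H).Nondegenerate) (hW : W ≤ H) :
    Module.finrank K ↥(H ⊓ W.orthogonalBilin B) + Module.finrank K W = Module.finrank K H := by
  have horth : H ⊓ W.orthogonalBilin B =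
      (LinearMap.BilinForm.orthogonal (B.domRestrict₁₂ H H)
        (W.comap H.subtype)).map H.subtype := by
    ext f
    constructor
    · rintro ⟨hf, h⟩
      exact ⟨⟨f, hf⟩, fun F hF => h F hF, rfl⟩
    · rintro ⟨f, h, rfl⟩
      exact ⟨f.2, fun F hF => h ⟨F, hW hF⟩ hF⟩
  rw [horth, Submodule.finrank_map_subtype_eq, LinearMap.BilinForm.finrank_orthogonal hB,
    (Submodule.comapSubtypeEquivOfLe hW).finrank_eq, Nat.sub_add_cancel (Submodule.finrank_mono hW)]

end LinearAlgebra

/-! ### Homogeneous polynomials -/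

section Homogeneous

variable {σ K : Type*} [CommRing K]

lemma finrank_homogeneousSubmodule [Nontrivial K] [Fintype σ] (m : ℕ) :
    Module.finrank K (homogeneousSubmodule σ K m) = (Fintype.card σ + m - 1).choose m := by
  classical
  let e : Sym σ m ≃ {β : σ →₀ ℕ | β.degree = m} :=
    (Sym.equivNatSum σ m).trans (Equiv.subtypeEquivRight fun β => by
      simp [Finsupp.sum, Finsupp.degree_apply])
  rw [homogeneousSubmodule_eq_finsupp_supported, ← restrictSupport,
    Module.finrank_eq_nat_card_basis (basisRestrictSupport K _), ← Nat.card_congr e,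
    Nat.card_eq_fintype_card, Sym.card_sym_eq_choose]

lemma homogeneousComponent_mul_of_right {d : ℕ} (m : ℕ) (P : MvPolynomial σ K)
    {Q : MvPolynomial σ K} (hQ : Q.IsHomogeneous d) :
    homogeneousComponent m (P * Q) =
      if d ≤ m then homogeneousComponent (m - d) P * Q else 0 := by
  induction P using MvPolynomial.induction_on' with
  | monomial β c =>
    have hβ : (monomial β c).IsHomogeneous β.degree := isHomogeneous_monomial c rfl
    rw [homogeneousComponent_of_mem (hβ.mul hQ), homogeneousComponent_of_mem hβ]
    split_ifs <;> first | omega | simp only [zero_mul]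
  | add P P' hP hP' =>
    rw [add_mul, map_add, hP, hP', map_add, add_mul]
    split_ifs <;> simp

lemma map_aeval_homogeneousSubmodule {A : Type*} [CommRing A] [Algebra K A] (u : σ → A) (m : ℕ) :
    (homogeneousSubmodule σ K m).map (aeval u).toLinearMap =
      Submodule.span K (Set.range u) ^ m := by
  rw [← homogeneousSubmodule_one_pow, homogeneousSubmodule_one_eq_span_X, Submodule.map_pow,
    Submodule.map_span, ← Set.range_comp]
  congr 3
  ext i
  simp

lemma span_range_pow_eq_span {A : Type*} [CommRing A] [Algebra K A] {n : ℕ} (u : Fin (n + 1) → A)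
    (m : ℕ) : Submodule.span K (Set.range u) ^ m =
      Submodule.span K ((fun α : Fin n →₀ ℕ => u 0 ^ (m - α.degree) * ∏ j, u j.succ ^ α j) ''
        {α | α.degree ≤ m}) := by
  have haeval (β : Fin (n + 1) →₀ ℕ) :
      aeval u (monomial β (1 : K)) = u 0 ^ β 0 * ∏ j, u j.succ ^ β.tail j := by
    rw [aeval_monomial, map_one, one_mul, Finsupp.prod_fintype _ _ (by simp), Fin.prod_univ_succ]
    rfl
  have hdegree (β : Fin (n + 1) →₀ ℕ) : β.degree = β 0 + β.tail.degree := by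
    simp [Finsupp.degree_eq_sum, Fin.sum_univ_succ, Finsupp.tail_apply]
  rw [← map_aeval_homogeneousSubmodule, homogeneousSubmodule_eq_finsupp_supported,
    ← restrictSupport, restrictSupport_eq_span, Submodule.map_span, Set.image_image]
  congr 1
  ext v
  constructor
  · rintro ⟨β, rfl : β.degree = m, rfl⟩
    refine ⟨β.tail, ?_, ?_⟩
    · exact (hdegree β).symm ▸ Nat.le_add_left _ _
    · beta_reduce
      rw [hdegree, Nat.add_sub_cancel]
      exact (haeval β).symm
  · rintro ⟨α, hα : α.degree ≤ m, rfl⟩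
    refine ⟨α.cons (m - α.degree), ?_, ?_⟩
    · rw [Set.mem_ofPred_eq, hdegree, Finsupp.cons_zero, Finsupp.tail_cons, Nat.sub_add_cancel hα]
    · exact (haeval _).trans (by rw [Finsupp.cons_zero, Finsupp.tail_cons])

end Homogeneous

/-! ### Forms -/

section Forms

variable {n : ℕ}

lemma forms_of_neg {t : ℤ} (ht : t < 0) : forms n t = ⊥ := by
  obtain ⟨m, rfl⟩ := Int.eq_negSucc_of_lt_zero ht
  rfl

instance finiteDimensional_forms (t : ℤ) : FiniteDimensional ℂ (forms n t) := by
  rcases t with m | m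
  · exact Module.Finite.of_fg (homogeneousSubmodule_fg (Fin (n + 1)) ℂ m)
  · exact inferInstanceAs (FiniteDimensional ℂ (⊥ : Submodule ℂ (MvPolynomial (Fin (n + 1)) ℂ)))

lemma finrank_forms (t : ℤ) : Module.finrank ℂ (forms n t) = numDerivs n t := by
  rcases t with m | _
  · refine (finrank_homogeneousSubmodule m).trans ?_
    rw [Fintype.card_fin, Nat.add_right_comm, Nat.add_sub_cancel, ← Nat.choose_symm_add]
    rfl
  · exact finrank_bot ℂ _

lemma isHomogeneous_linForm (a : Fin (n + 1) → ℂ) : (linForm a).IsHomogeneous 1 :=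
  IsHomogeneous.sum _ _ _ fun _ _ => isHomogeneous_C_mul_X _ _

lemma isHomogeneous_linForm_pow (a : Fin (n + 1) → ℂ) (k : ℕ) :
    (linForm a ^ k).IsHomogeneous k := by
  simpa using (isHomogeneous_linForm a).pow k

lemma linForm_ne_zero {a : Fin (n + 1) → ℂ} (ha : a ≠ 0) : linForm a ≠ 0 := by
  contrapose! ha
  ext j
  have hcoeff : coeff (Finsupp.single j 1) (linForm a) = a j := by
    classical simp [linForm, coeff_sum, coeff_C_mul, coeff_X, Finsupp.single_left_inj]
  simp [← hcoeff, ha]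

lemma linForm_smul (c : ℂ) (a : Fin (n + 1) → ℂ) : linForm (c • a) = c • linForm a := by
  simp [linForm, Finset.smul_sum, smul_eq_C_mul, mul_assoc]

lemma exists_eq_linForm {L : MvPolynomial (Fin (n + 1)) ℂ} (hL : L ∈ forms n 1) :
    ∃ a, L = linForm a := by
  change L ∈ homogeneousSubmodule (Fin (n + 1)) ℂ 1 at hL
  rw [homogeneousSubmodule_one_eq_span_X, Submodule.mem_span_range_iff_exists_fun] at hL
  obtain ⟨a, rfl⟩ := hL
  exact ⟨a, by simp [linForm, smul_eq_C_mul]⟩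

lemma mul_mem_forms {m : ℕ} {t : ℤ} {P Q : MvPolynomial (Fin (n + 1)) ℂ}
    (hP : P.IsHomogeneous m) (hQ : Q ∈ forms n t) : P * Q ∈ forms n (t + m) := by
  rcases t with t | t
  · have hPQ : P * Q ∈ forms n ((t + m : ℕ) : ℤ) := add_comm m t ▸ hP.mul hQ
    exact_mod_cast hPQ
  · obtain rfl : Q = 0 := hQ
    simp

/-- The component in `R_t` of a polynomial, for an integer `t`. -/
noncomputable def formComponent (n : ℕ) (t : ℤ) :
    MvPolynomial (Fin (n + 1)) ℂ →ₗ[ℂ] MvPolynomial (Fin (n + 1)) ℂ :=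
  match t with
  | Int.ofNat m => homogeneousComponent m
  | Int.negSucc _ => 0

lemma formComponent_of_neg {t : ℤ} (ht : t < 0) : formComponent n t = 0 := by
  obtain ⟨m, rfl⟩ := Int.eq_negSucc_of_lt_zero ht
  rfl

lemma formComponent_mem (t : ℤ) (P : MvPolynomial (Fin (n + 1)) ℂ) :
    formComponent n t P ∈ forms n t := by
  rcases t with m | m
  · exact homogeneousComponent_isHomogeneous m P
  · exact Submodule.zero_mem _

lemma formComponent_eq_self {t : ℤ} {P : MvPolynomial (Fin (n + 1)) ℂ} (hP : P ∈ forms n t) :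
    formComponent n t P = P := by
  rcases t with m | m
  · exact homogeneousComponent_eq_self hP
  · exact ((Submodule.mem_bot ℂ).1 hP).symm

lemma formComponent_mul_of_right {d : ℕ} (t : ℤ) (P : MvPolynomial (Fin (n + 1)) ℂ)
    {Q : MvPolynomial (Fin (n + 1)) ℂ} (hQ : Q.IsHomogeneous d) :
    formComponent n t (P * Q) = formComponent n (t - d) P * Q := by
  rcases lt_or_ge t 0 with ht | ht
  · rw [formComponent_of_neg ht, formComponent_of_neg (by omega)]
    simp
  lift t to ℕ using ht
  have hcomp := homogeneousComponent_mul_of_right t P hQ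
  split_ifs at hcomp with h
  · rw [← Nat.cast_sub h]
    exact hcomp
  · rw [formComponent_of_neg (show (t : ℤ) - d < 0 by omega), LinearMap.zero_apply, zero_mul]
    exact hcomp

lemma mem_forms_of_mul_mem {k : ℕ} {t : ℤ} {P Q : MvPolynomial (Fin (n + 1)) ℂ}
    (hP : P.IsHomogeneous k) (hP₀ : P ≠ 0) (h : P * Q ∈ forms n t) : Q ∈ forms n (t - k) := by
  have hcomp := formComponent_eq_self h
  rw [mul_comm, formComponent_mul_of_right _ _ hP] at hcomp
  rw [← mul_right_cancel₀ hP₀ hcomp]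
  exact formComponent_mem _ _

end Forms

/-! ### General points -/

section GeneralPoints

variable {m n : ℕ}

lemma ForGeneral.mono {P Q : (Fin m → ℂ) → Prop} (hP : ForGeneral P) (h : ∀ a, P a → Q a) :
    ForGeneral Q :=
  let ⟨p, hp, hp'⟩ := hP
  ⟨p, hp, fun a ha => h a (hp' a ha)⟩

lemma ForGeneral.and {P Q : (Fin m → ℂ) → Prop} (hP : ForGeneral P) (hQ : ForGeneral Q) :
    ForGeneral fun a => P a ∧ Q a :=
  let ⟨p, hp, hp'⟩ := hP
  let ⟨q, hq, hq'⟩ := hQ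
  ⟨p * q, mul_ne_zero hp hq, fun a ha => by
    rw [map_mul] at ha
    exact ⟨hp' a (left_ne_zero_of_mul ha), hq' a (right_ne_zero_of_mul ha)⟩⟩

lemma ForGeneral.exists {P : (Fin m → ℂ) → Prop} (hP : ForGeneral P) : ∃ a, P a := by
  obtain ⟨p, hp, hp'⟩ := hP
  contrapose! hp
  exact MvPolynomial.funext fun a => by_contra fun ha => hp a (hp' a (by simpa using ha))

lemma forGeneral_apply_zero_ne_zero : ForGeneral fun a : Fin (n + 1) → ℂ => a 0 ≠ 0 :=
  ⟨X 0, X_ne_zero 0, fun a ha => by simpa using ha⟩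

lemma forGeneral_ne_zero : ForGeneral fun a : Fin (n + 1) → ℂ => a ≠ 0 :=
  forGeneral_apply_zero_ne_zero.mono fun a ha h => ha (by simp [h])

lemma smul_cons_one_eq {a : Fin (n + 1) → ℂ} (ha : a 0 ≠ 0) :
    a 0 • (Fin.cons 1 fun j : Fin n => (a 0)⁻¹ * a j.succ : Fin (n + 1) → ℂ) = a := by
  ext j
  cases j using Fin.cases <;> simp [ha]

lemma ForGeneral.cons_one {P : (Fin (n + 1) → ℂ) → Prop} (hP : ForGeneral P)
    (hsmul : ∀ (c : ℂ) (a : Fin (n + 1) → ℂ), c ≠ 0 → P (c • a) → P a) :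
    ForGeneral fun y : Fin n → ℂ => P (Fin.cons 1 y) := by
  obtain ⟨Q, hQ, hQP⟩ := hP
  obtain ⟨a, ha, ha₀⟩ := ForGeneral.exists
    (ForGeneral.and ⟨Q, hQ, fun _ h => h⟩ (forGeneral_apply_zero_ne_zero (n := n)))
  let q : MvPolynomial (Fin n) ℂ :=
    aeval (Fin.cons (C (a 0)) fun j => C (a 0) * X j : Fin (n + 1) → MvPolynomial (Fin n) ℂ) Q
  have hq (y : Fin n → ℂ) : eval y q = eval (a 0 • (Fin.cons 1 y : Fin (n + 1) → ℂ)) Q := by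
    rw [← coe_aeval_eq_eval, ← coe_aeval_eq_eval]
    change (aeval y) (aeval _ Q) = aeval _ Q
    rw [← AlgHom.comp_apply]
    congr 1
    ext j
    cases j using Fin.cases <;> simp
  refine ⟨q, fun h => ha ?_, fun y hy => hsmul (a 0) _ ha₀ (hQP _ (hq y ▸ hy))⟩
  rw [← smul_cons_one_eq ha₀, ← hq, h, map_zero]

end GeneralPoints

/-! ### Multiplication by a form -/

section Multiplication

variable {n : ℕ} (I : Ideal (MvPolynomial (Fin (n + 1)) ℂ))

lemma ker_mkₐ_toLinearMap :
    LinearMap.ker (Ideal.Quotient.mkₐ ℂ I).toLinearMap = I.restrictScalars ℂ := by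
  ext P
  simp [Ideal.Quotient.eq_zero_iff_mem]

instance finiteDimensional_idealPiece (t : ℤ) : FiniteDimensional ℂ (idealPiece I t) :=
  Submodule.finiteDimensional_of_le (inf_le_right : _ ≤ forms n t)

instance finiteDimensional_quotPiece (t : ℤ) : FiniteDimensional ℂ (quotPiece I t) :=
  Module.Finite.map (forms n t) _

lemma finrank_quotPiece_add_finrank_idealPiece (t : ℤ) :
    Module.finrank ℂ (quotPiece I t) + Module.finrank ℂ (idealPiece I t) =
      Module.finrank ℂ (forms n t) := by
  have h := finrank_map_add_finrank_inf_ker (Ideal.Quotient.mkₐ ℂ I).toLinearMap (forms n t)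
  rwa [ker_mkₐ_toLinearMap, inf_comm] at h

/-- The subspace `P R_s` of `R`. -/
noncomputable def formMultiples (P : MvPolynomial (Fin (n + 1)) ℂ) (s : ℤ) :
    Submodule ℂ (MvPolynomial (Fin (n + 1)) ℂ) :=
  (forms n s).map (LinearMap.mulLeft ℂ P)

/-- The subspace `P A_s` of `A = R / I`. -/
noncomputable def mulImage (P : MvPolynomial (Fin (n + 1)) ℂ) (s : ℤ) :
    Submodule ℂ (MvPolynomial (Fin (n + 1)) ℂ ⧸ I) :=
  (quotPiece I s).map (LinearMap.mulLeft ℂ (Ideal.Quotient.mk I P))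

/-- The rank of the multiplication by `P` on the graded piece `A_s` of `A = R / I`. -/
noncomputable def mulRank (P : MvPolynomial (Fin (n + 1)) ℂ) (s : ℤ) : ℕ :=
  Module.finrank ℂ (mulImage I P s)

variable {I} {P : MvPolynomial (Fin (n + 1)) ℂ} {k : ℕ} (s : ℤ)

lemma mem_formMultiples {s : ℤ} {Q : MvPolynomial (Fin (n + 1)) ℂ} :
    Q ∈ formMultiples P s ↔ ∃ G ∈ forms n s, P * G = Q := Iff.rfl

lemma formMultiples_le (hP : P.IsHomogeneous k) : formMultiples P s ≤ forms n (s + k) := by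
  rintro _ ⟨G, hG, rfl⟩
  exact mul_mem_forms hP hG

instance finiteDimensional_formMultiples : FiniteDimensional ℂ (formMultiples P s) :=
  Module.Finite.map (forms n s) _

instance finiteDimensional_mulImage : FiniteDimensional ℂ (mulImage I P s) :=
  Module.Finite.map (quotPiece I s) _

lemma finrank_formMultiples (hP : P ≠ 0) :
    Module.finrank ℂ (formMultiples P s) = Module.finrank ℂ (forms n s) :=
  ((forms n s).equivMapOfInjective _ (mul_right_injective₀ hP)).finrank_eq.symm

lemma map_mkₐ_formMultiples :
    (formMultiples P s).map (Ideal.Quotient.mkₐ ℂ I).toLinearMap = mulImage I P s := by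
  rw [formMultiples, mulImage, quotPiece, ← Submodule.map_comp, ← Submodule.map_comp]
  congr 1

lemma mulImage_le (hP : P.IsHomogeneous k) : mulImage I P s ≤ quotPiece I (s + k) := by
  rw [← map_mkₐ_formMultiples]
  exact Submodule.map_mono (formMultiples_le s hP)

lemma mulRank_le_finrank_source : mulRank I P s ≤ Module.finrank ℂ (quotPiece I s) :=
  Submodule.finrank_map_le _ _

lemma mulRank_le_finrank_target (hP : P.IsHomogeneous k) :
    mulRank I P s ≤ Module.finrank ℂ (quotPiece I (s + k)) :=
  Submodule.finrank_mono (mulImage_le s hP)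

lemma mulRank_add_finrank_formMultiples_inf (hP : P.IsHomogeneous k) (hP₀ : P ≠ 0) :
    mulRank I P s + Module.finrank ℂ ↥(formMultiples P s ⊓ idealPiece I (s + k)) =
      Module.finrank ℂ (forms n s) := by
  have h := finrank_map_add_finrank_inf_ker (Ideal.Quotient.mkₐ ℂ I).toLinearMap
    (formMultiples P s)
  rwa [ker_mkₐ_toLinearMap, map_mkₐ_formMultiples, finrank_formMultiples s hP₀,
    ← inf_eq_left.2 (formMultiples_le s hP), inf_assoc, inf_comm (forms n (s + k))] at h

lemma mulRank_smul {c : ℂ} (hc : c ≠ 0) : mulRank I (c • P) s = mulRank I P s := by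
  have hmul : LinearMap.mulLeft ℂ (Ideal.Quotient.mk I (c • P)) =
      c • LinearMap.mulLeft ℂ (Ideal.Quotient.mk I P) := by
    ext1 x
    exact smul_mul_assoc c (Ideal.Quotient.mk I P) x
  rw [mulRank, mulImage, hmul, Submodule.map_smul _ _ _ hc, mulRank, mulImage]

lemma hasMaximalRank_iff_mulRank {L : MvPolynomial (Fin (n + 1)) ℂ} (hL : L.IsHomogeneous 1) :
    HasMaximalRank I L k s ↔ mulRank I (L ^ k) s =
      min (Module.finrank ℂ (quotPiece I s)) (Module.finrank ℂ (quotPiece I (s + k))) := by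
  have hLk : (L ^ k).IsHomogeneous k := by simpa using hL.pow k
  have hinj : Set.InjOn (fun x => Ideal.Quotient.mk I L ^ k * x) (quotPiece I s) ↔
      mulRank I (L ^ k) s = Module.finrank ℂ (quotPiece I s) := by
    have h := finrank_map_add_finrank_inf_ker
      (LinearMap.mulLeft ℂ (Ideal.Quotient.mk I (L ^ k))) (quotPiece I s)
    rw [← h, mulRank, mulImage, eq_comm, Nat.add_eq_left, Submodule.finrank_eq_zero,
      ← disjoint_iff, LinearMap.disjoint_ker_iff_injOn, map_pow]
    rfl
  have hsurj : Set.SurjOn (fun x => Ideal.Quotient.mk I L ^ k * x) (quotPiece I s)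
      (quotPiece I (s + k)) ↔ mulRank I (L ^ k) s = Module.finrank ℂ (quotPiece I (s + k)) := by
    trans quotPiece I (s + k) ≤ mulImage I (L ^ k) s
    · rw [mulImage, map_pow]
      rfl
    · exact ⟨fun h => le_antisymm (mulRank_le_finrank_target s hLk) (Submodule.finrank_mono h),
        fun h => (Submodule.eq_of_le_of_finrank_eq (mulImage_le s hLk) h).ge⟩
  have hsource := mulRank_le_finrank_source (I := I) (P := L ^ k) s
  have htarget := mulRank_le_finrank_target (I := I) s hLk
  rw [HasMaximalRank, hinj, hsurj]
  omega

end Multiplication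

/-! ### The rank of a general multiplication -/

section GeneralRank

variable {n : ℕ} (I : Ideal (MvPolynomial (Fin (n + 1)) ℂ)) (k : ℕ) (s : ℤ)

/-- The rank of `×L ^ k : A_s → A_{s+k}` for a general linear form `L`, defined as the largest
rank that occurs. -/
noncomputable def generalRank : ℕ :=
  sSup (Set.range fun a : Fin (n + 1) → ℂ => mulRank I (linForm a ^ k) s)

/-- The amount by which the rank of `×L ^ k : A_s → A_{s+k}` falls short of the maximum allowed by
the dimensions, for a general linear form `L`. -/
noncomputable def rankDefect : ℕ :=
  min (Module.finrank ℂ (quotPiece I s)) (Module.finrank ℂ (quotPiece I (s + k))) -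
    generalRank I k s

lemma bddAbove_mulRank :
    BddAbove (Set.range fun a : Fin (n + 1) → ℂ => mulRank I (linForm a ^ k) s) :=
  ⟨_, Set.forall_mem_range.2 fun _ => mulRank_le_finrank_source s⟩

lemma mulRank_le_generalRank (a : Fin (n + 1) → ℂ) :
    mulRank I (linForm a ^ k) s ≤ generalRank I k s :=
  le_csSup (bddAbove_mulRank I k s) ⟨a, rfl⟩

lemma exists_mulRank_eq_generalRank :
    ∃ a : Fin (n + 1) → ℂ, mulRank I (linForm a ^ k) s = generalRank I k s :=
  Nat.sSup_mem (Set.range_nonempty _) (bddAbove_mulRank I k s)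

lemma generalRank_add_rankDefect : generalRank I k s + rankDefect I k s =
    min (Module.finrank ℂ (quotPiece I s)) (Module.finrank ℂ (quotPiece I (s + k))) := by
  obtain ⟨a, ha⟩ := exists_mulRank_eq_generalRank I k s
  refine Nat.add_sub_of_le (ha ▸ le_min (mulRank_le_finrank_source s) ?_)
  exact mulRank_le_finrank_target s (isHomogeneous_linForm_pow a k)

lemma exists_eval_eq_apply_linForm_pow_mul
    (φ : Module.Dual ℂ (MvPolynomial (Fin (n + 1)) ℂ)) (G : MvPolynomial (Fin (n + 1)) ℂ) :
    ∃ p : MvPolynomial (Fin (n + 1)) ℂ, ∀ a, eval a p = φ (linForm a ^ k * G) := by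
  induction k generalizing G with
  | zero => exact ⟨C (φ G), fun a => by simp⟩
  | succ k ih =>
    choose p hp using fun j => ih (X j * G)
    refine ⟨∑ j, X j * p j, fun a => ?_⟩
    have hexpand : linForm a ^ (k + 1) * G = ∑ j, a j • (linForm a ^ k * (X j * G)) := by
      rw [pow_succ, mul_assoc, linForm.eq_1 a, Finset.sum_mul, Finset.mul_sum]
      exact Finset.sum_congr rfl fun j _ => by rw [smul_eq_C_mul]; ring
    simp [hexpand, hp]

lemma forGeneral_mulRank_eq_generalRank :
    ForGeneral fun a : Fin (n + 1) → ℂ => mulRank I (linForm a ^ k) s = generalRank I k s := by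
  obtain ⟨a₀, ha₀⟩ := exists_mulRank_eq_generalRank I k s
  let T (a : Fin (n + 1) → ℂ) : forms n s →ₗ[ℂ] MvPolynomial (Fin (n + 1)) ℂ ⧸ I :=
    ((Ideal.Quotient.mkₐ ℂ I).toLinearMap ∘ₗ LinearMap.mulLeft ℂ (linForm a ^ k)).domRestrict _
  have hT (a) : Module.finrank ℂ (LinearMap.range (T a)) = mulRank I (linForm a ^ k) s := by
    rw [LinearMap.range_domRestrict, Submodule.map_comp, ← formMultiples, map_mkₐ_formMultiples,
      mulRank]
  obtain ⟨q, hq, hqT⟩ := exists_polynomial_finrank_range_le T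
    (fun φ G =>
      exists_eval_eq_apply_linForm_pow_mul k (φ ∘ₗ (Ideal.Quotient.mkₐ ℂ I).toLinearMap) G) a₀
  refine ⟨q, by rintro rfl; simp at hq, fun a ha => le_antisymm (mulRank_le_generalRank I k s a) ?_⟩
  rw [← ha₀, ← hT, ← hT]
  exact hqT a ha

lemma forGeneral_mulRank_cons_one_eq_generalRank :
    ForGeneral fun y : Fin n → ℂ =>
      mulRank I (linForm (Fin.cons 1 y) ^ k) s = generalRank I k s :=
  (forGeneral_mulRank_eq_generalRank I k s).cons_one fun c a hc ha => by
    rwa [linForm_smul, smul_pow, mulRank_smul s (pow_ne_zero k hc)] at ha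

lemma failsSLPAt_iff_one_le_rankDefect : FailsSLPAt I k s ↔ 1 ≤ rankDefect I k s := by
  have hdefect := generalRank_add_rankDefect I k s
  constructor
  · intro h
    obtain ⟨a, ha⟩ := exists_mulRank_eq_generalRank I k s
    have hmax := h _ (isHomogeneous_linForm a)
    rw [hasMaximalRank_iff_mulRank s (isHomogeneous_linForm a)] at hmax
    omega
  · intro h L hL
    obtain ⟨a, rfl⟩ := exists_eq_linForm hL
    have hle := mulRank_le_generalRank I k s a
    rw [hasMaximalRank_iff_mulRank s (isHomogeneous_linForm a)]
    omega

end GeneralRank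

/-! ### Relations modulo a form -/

section Relations

variable {n r : ℕ}

/-- The space `R_m^r` of vectors of forms of degree `m`. -/
noncomputable def formVectors (n r : ℕ) (m : ℤ) :
    Submodule ℂ (Fin r → MvPolynomial (Fin (n + 1)) ℂ) :=
  Submodule.pi Set.univ fun _ => forms n m

/-- The map `(G_1, …, G_r) ↦ G_1 F_1 + ⋯ + G_r F_r`, whose kernel is the module of syzygies. -/
noncomputable def combination (F : Fin r → MvPolynomial (Fin (n + 1)) ℂ) :
    (Fin r → MvPolynomial (Fin (n + 1)) ℂ) →ₗ[ℂ] MvPolynomial (Fin (n + 1)) ℂ :=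
  (Fintype.linearCombination (MvPolynomial (Fin (n + 1)) ℂ) F).restrictScalars ℂ

/-- The componentwise reduction of a vector modulo `P`. -/
noncomputable def vectorMod (r : ℕ) (P : MvPolynomial (Fin (n + 1)) ℂ) :
    (Fin r → MvPolynomial (Fin (n + 1)) ℂ) →ₗ[ℂ]
      (Fin r → MvPolynomial (Fin (n + 1)) ℂ ⧸ Ideal.span {P}) :=
  (Ideal.Quotient.mkₐ ℂ (Ideal.span {P})).toLinearMap.compLeft (Fin r)

/-- The relations of degree `m` modulo `P`: the vectors of forms `(G_1, …, G_r)` of degree `m` such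
that `G_1 F_1 + ⋯ + G_r F_r` is the product of `P` and a form of degree `s`. -/
noncomputable def relationsModulo (F : Fin r → MvPolynomial (Fin (n + 1)) ℂ)
    (P : MvPolynomial (Fin (n + 1)) ℂ) (m s : ℤ) :
    Submodule ℂ (Fin r → MvPolynomial (Fin (n + 1)) ℂ) :=
  formVectors n r m ⊓ (formMultiples P s).comap (combination F)

lemma mem_formVectors {m : ℤ} {G : Fin r → MvPolynomial (Fin (n + 1)) ℂ} :
    G ∈ formVectors n r m ↔ ∀ j, G j ∈ forms n m := by
  simp [formVectors]

lemma combination_apply (F G : Fin r → MvPolynomial (Fin (n + 1)) ℂ) :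
    combination F G = ∑ j, G j * F j := rfl

lemma finrank_formVectors (m : ℤ) :
    Module.finrank ℂ (formVectors n r m) = r * Module.finrank ℂ (forms n m) := by
  rw [formVectors, finrank_pi_univ, Fintype.card_fin]

instance finiteDimensional_formVectors (m : ℤ) : FiniteDimensional ℂ (formVectors n r m) := by
  rw [formVectors, ← Submodule.range_subtype (forms n m), ← LinearMap.range_compLeft]
  infer_instance

instance finiteDimensional_relationsModulo (F : Fin r → MvPolynomial (Fin (n + 1)) ℂ)
    (P : MvPolynomial (Fin (n + 1)) ℂ) (m s : ℤ) :
    FiniteDimensional ℂ (relationsModulo F P m s) :=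
  Submodule.finiteDimensional_of_le (inf_le_left : _ ≤ formVectors n r m)

lemma idealPiece_span_singleton {P : MvPolynomial (Fin (n + 1)) ℂ} {k : ℕ} (hP : P.IsHomogeneous k)
    (hP₀ : P ≠ 0) (m : ℤ) : idealPiece (Ideal.span {P}) m = formMultiples P (m - k) := by
  ext Q
  constructor
  · rintro ⟨hQ, hQm⟩
    obtain ⟨G, rfl⟩ := Ideal.mem_span_singleton.1 hQ
    exact ⟨G, mem_forms_of_mul_mem hP hP₀ hQm, rfl⟩
  · intro hQ
    refine ⟨?_, sub_add_cancel m (k : ℤ) ▸ formMultiples_le (m - k) hP hQ⟩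
    obtain ⟨G, -, rfl⟩ := hQ
    exact Ideal.mem_span_singleton.2 (dvd_mul_right P G)

lemma formVectors_inf_ker_vectorMod (P : MvPolynomial (Fin (n + 1)) ℂ) (m : ℤ) :
    formVectors n r m ⊓ LinearMap.ker (vectorMod r P) =
      Submodule.pi Set.univ fun _ => idealPiece (Ideal.span {P}) m := by
  rw [vectorMod, LinearMap.ker_compLeft, ker_mkₐ_toLinearMap]
  ext G
  simp [formVectors, idealPiece, forall_and, and_comm]

lemma finrank_formVectors_inf_ker_vectorMod {P : MvPolynomial (Fin (n + 1)) ℂ} {k : ℕ}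
    (hP : P.IsHomogeneous k) (hP₀ : P ≠ 0) (m : ℤ) :
    Module.finrank ℂ ↥(formVectors n r m ⊓ LinearMap.ker (vectorMod r P)) =
      r * Module.finrank ℂ (forms n (m - k)) := by
  rw [formVectors_inf_ker_vectorMod, finrank_pi_univ, Fintype.card_fin,
    idealPiece_span_singleton hP hP₀, finrank_formMultiples _ hP₀]

variable {d i : ℕ} {F : Fin r → MvPolynomial (Fin (n + 1)) ℂ}

lemma combination_mem_forms (hF : ∀ j, (F j).IsHomogeneous d) {m : ℤ}
    {G : Fin r → MvPolynomial (Fin (n + 1)) ℂ} (hG : G ∈ formVectors n r m) :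
    combination F G ∈ forms n (d + m) := by
  rw [combination_apply]
  refine Submodule.sum_mem _ fun j _ => ?_
  rw [mul_comm, add_comm (d : ℤ)]
  exact mul_mem_forms (hF j) (mem_formVectors.1 hG j)

lemma map_combination_formVectors (hF : ∀ j, (F j).IsHomogeneous d) (m : ℤ) :
    (formVectors n r m).map (combination F) = idealPiece (Ideal.span (Set.range F)) (d + m) := by
  ext P
  constructor
  · rintro ⟨G, hG, rfl⟩
    refine ⟨?_, combination_mem_forms hF hG⟩
    rw [combination_apply]
    exact Ideal.sum_mem _ fun j _ => Ideal.mul_mem_left _ _ (Ideal.subset_span ⟨j, rfl⟩)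
  · rintro ⟨hP, hPm⟩
    obtain ⟨G, rfl⟩ := Ideal.mem_span_range_iff_exists_fun.1 hP
    refine ⟨fun j => formComponent n m (G j), mem_formVectors.2 fun j => formComponent_mem m _, ?_⟩
    rw [combination_apply, ← formComponent_eq_self hPm, map_sum]
    exact Finset.sum_congr rfl fun j _ => by
      rw [formComponent_mul_of_right _ _ (hF j), add_sub_cancel_left]

lemma NoSyzygy.disjoint_ker (hsyz : NoSyzygy F i) :
    Disjoint (formVectors n r i) (LinearMap.ker (combination F)) :=
  Submodule.disjoint_def.2 fun G hG h => hsyz G (mem_formVectors.1 hG) h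

lemma NoSyzygy.disjoint_ker_sub (hsyz : NoSyzygy F i) (k : ℕ) :
    Disjoint (formVectors n r (i - k)) (LinearMap.ker (combination F)) := by
  refine Submodule.disjoint_def.2 fun G hG h => ?_
  have hX : ((X 0 : MvPolynomial (Fin (n + 1)) ℂ) ^ k).IsHomogeneous k := isHomogeneous_X_pow 0 k
  have hXG := hsyz (fun j => X 0 ^ k * G j)
    (fun j => sub_add_cancel (i : ℤ) k ▸ mul_mem_forms hX (mem_formVectors.1 hG j))
    (by simp_rw [mul_assoc, ← Finset.mul_sum, ← combination_apply, LinearMap.mem_ker.1 h, mul_zero])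
  exact funext fun j => (mul_eq_zero_iff_left (pow_ne_zero k (X_ne_zero 0))).1 (congrFun hXG j)

lemma finrank_idealPiece_of_disjoint_ker (hF : ∀ j, (F j).IsHomogeneous d) {m : ℤ}
    (h : Disjoint (formVectors n r m) (LinearMap.ker (combination F))) :
    Module.finrank ℂ (idealPiece (Ideal.span (Set.range F)) (d + m)) =
      r * Module.finrank ℂ (forms n m) := by
  rw [← map_combination_formVectors hF, finrank_map_of_disjoint_ker h, finrank_formVectors]

lemma numN_eq (hF : ∀ j, (F j).IsHomogeneous d) (hsyz : NoSyzygy F i) (k : ℕ) :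
    numN n r i k d = Module.finrank ℂ (quotPiece (Ideal.span (Set.range F)) ((d : ℤ) + i - k)) -
      Module.finrank ℂ (quotPiece (Ideal.span (Set.range F)) ((d : ℤ) + i)) := by
  have hi := finrank_idealPiece_of_disjoint_ker hF hsyz.disjoint_ker
  have hik := finrank_idealPiece_of_disjoint_ker hF (hsyz.disjoint_ker_sub k)
  have hA := finrank_quotPiece_add_finrank_idealPiece (Ideal.span (Set.range F)) ((d : ℤ) + i)
  have hA' := finrank_quotPiece_add_finrank_idealPiece (Ideal.span (Set.range F)) ((d : ℤ) + i - k)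
  rw [← add_sub_assoc] at hik
  rw [numN, dimForms, dimForms, dimForms, dimForms]
  zify at hi hik hA hA'
  linear_combination hA - hA' - hi + hik

lemma finrank_relationsModulo (hF : ∀ j, (F j).IsHomogeneous d) (hsyz : NoSyzygy F i)
    (P : MvPolynomial (Fin (n + 1)) ℂ) (s : ℤ) :
    Module.finrank ℂ (relationsModulo F P i s) =
      Module.finrank ℂ ↥(formMultiples P s ⊓ idealPiece (Ideal.span (Set.range F)) (d + i)) := by
  rw [relationsModulo, ← finrank_map_of_disjoint_ker (hsyz.disjoint_ker.mono_left inf_le_left),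
    ← Submodule.map_inf_eq_map_inf_comap, map_combination_formVectors hF, inf_comm]

variable {k : ℕ} {P : MvPolynomial (Fin (n + 1)) ℂ}

lemma formVectors_inf_ker_vectorMod_le (hF : ∀ j, (F j).IsHomogeneous d) (hP : P.IsHomogeneous k)
    (hP₀ : P ≠ 0) (m : ℤ) : formVectors n r m ⊓ LinearMap.ker (vectorMod r P) ≤
      relationsModulo F P m (d + m - k) := by
  refine fun G hG => ⟨hG.1, ?_⟩
  rw [SetLike.mem_coe, Submodule.mem_comap, ← idealPiece_span_singleton hP hP₀]
  refine ⟨?_, combination_mem_forms hF hG.1⟩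
  rw [formVectors_inf_ker_vectorMod] at hG
  rw [combination_apply]
  exact Ideal.sum_mem _ fun j _ => Ideal.mul_mem_right _ _ (hG j trivial).1

lemma finrank_map_vectorMod_add_mulRank (hF : ∀ j, (F j).IsHomogeneous d) (hsyz : NoSyzygy F i)
    (hP : P.IsHomogeneous k) (hP₀ : P ≠ 0) :
    Module.finrank ℂ ((relationsModulo F P i ((d : ℤ) + i - k)).map (vectorMod r P)) +
        mulRank (Ideal.span (Set.range F)) P ((d : ℤ) + i - k) =
      Module.finrank ℂ (quotPiece (Ideal.span (Set.range F)) ((d : ℤ) + i - k)) := by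
  have hker : relationsModulo F P i ((d : ℤ) + i - k) ⊓ LinearMap.ker (vectorMod r P) =
      formVectors n r i ⊓ LinearMap.ker (vectorMod r P) :=
    le_antisymm (inf_le_inf_right _ inf_le_left)
      (le_inf (formVectors_inf_ker_vectorMod_le hF hP hP₀ i) inf_le_right)
  have hrel := finrank_map_add_finrank_inf_ker (vectorMod r P)
    (relationsModulo F P i ((d : ℤ) + i - k))
  rw [hker, finrank_formVectors_inf_ker_vectorMod hP hP₀, finrank_relationsModulo hF hsyz] at hrel
  have hmul := mulRank_add_finrank_formMultiples_inf (I := Ideal.span (Set.range F))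
    ((d : ℤ) + i - k) hP hP₀
  rw [sub_add_cancel] at hmul
  have hI := finrank_idealPiece_of_disjoint_ker hF (hsyz.disjoint_ker_sub k)
  rw [← add_sub_assoc] at hI
  have hA := finrank_quotPiece_add_finrank_idealPiece (Ideal.span (Set.range F)) ((d : ℤ) + i - k)
  omega

lemma exists_relations_iff (hF : ∀ j, (F j).IsHomogeneous d) (hsyz : NoSyzygy F i)
    (hP : P.IsHomogeneous k) (hP₀ : P ≠ 0) (c : ℕ) :
    (∃ (G : Fin c → Fin r → MvPolynomial (Fin (n + 1)) ℂ)
      (H : Fin c → MvPolynomial (Fin (n + 1)) ℂ),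
      (∀ l j, G l j ∈ forms n i) ∧
      (∀ l, H l ∈ forms n ((d : ℤ) + i - k)) ∧
      LinearIndependent ℂ (fun l j => Ideal.Quotient.mk (Ideal.span {P}) (G l j)) ∧
      ∀ l, ∑ j, G l j * F j = P * H l) ↔
    c + mulRank (Ideal.span (Set.range F)) P ((d : ℤ) + i - k) ≤
      Module.finrank ℂ (quotPiece (Ideal.span (Set.range F)) ((d : ℤ) + i - k)) := by
  rw [← finrank_map_vectorMod_add_mulRank hF hsyz hP hP₀, add_le_add_iff_right]
  set S := (relationsModulo F P i ((d : ℤ) + i - k)).map (vectorMod r P)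
  constructor
  · rintro ⟨G, H, hG, hH, hli, hGH⟩
    have hmem (l : Fin c) : vectorMod r P (G l) ∈ S :=
      ⟨G l, ⟨mem_formVectors.2 (hG l), H l, hH l, (hGH l).symm⟩, rfl⟩
    have hliS : LinearIndependent ℂ fun l => (⟨_, hmem l⟩ : S) :=
      LinearIndependent.of_comp S.subtype hli
    simpa using hliS.fintype_card_le_finrank
  · intro hc
    obtain ⟨v, hv⟩ := exists_linearIndependent_of_le_finrank hc
    choose G hG hGv using fun l => (v l).2
    choose H hH hGH using fun l => mem_formMultiples.1 (hG l).2
    refine ⟨G, H, fun l => mem_formVectors.1 (hG l).1, hH, ?_, fun l => (hGH l).symm⟩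
    change LinearIndependent ℂ fun l => vectorMod r P (G l)
    simp_rw [hGv]
    exact hv.map' S.subtype S.ker_subtype

end Relations

/-! ### Apolarity -/

section Apolarity

variable {A : Type*} [CommRing A] {m : ℕ}

/-- The apolarity pairing `∑_α α! F_α f_α`. On forms of the same degree it is `F(∂) f`. -/
noncomputable def apolarPairing (A : Type*) [CommRing A] (m : ℕ) :
    MvPolynomial (Fin m) A →ₗ[A] MvPolynomial (Fin m) A →ₗ[A] A :=
  (basisMonomials (Fin m) A).constr A fun α => (∏ j, (α j).factorial : A) • lcoeff A α

lemma apolarPairing_monomial_left (α : Fin m →₀ ℕ) (f : MvPolynomial (Fin m) A) :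
    apolarPairing A m (monomial α 1) f = (∏ j, (α j).factorial : A) * coeff α f := by
  have hbasis : basisMonomials (Fin m) A α = monomial α 1 := congrFun (coe_basisMonomials _ _) α
  rw [← hbasis, apolarPairing, Module.Basis.constr_basis]
  rfl

lemma apolarPairing_monomial_right (α : Fin m →₀ ℕ) (F : MvPolynomial (Fin m) A) :
    apolarPairing A m F (monomial α 1) = (∏ j, (α j).factorial : A) * coeff α F := by
  classical
  induction F using MvPolynomial.induction_on' with
  | add p q hp hq => simp [hp, hq, mul_add]
  | monomial β c =>
    rw [← mul_one c, ← smul_eq_mul, ← smul_monomial, map_smul, LinearMap.smul_apply,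
      apolarPairing_monomial_left, coeff_smul, coeff_monomial, coeff_monomial]
    rcases eq_or_ne α β with rfl | h
    · simp [mul_comm]
    · simp [h, h.symm]

lemma prod_factorial_add_single (α : Fin m →₀ ℕ) (j : Fin m) :
    ∏ l, ((α + Finsupp.single j 1 : Fin m →₀ ℕ) l).factorial =
      (α j + 1) * ∏ l, (α l).factorial := by
  rw [← Finset.mul_prod_erase _ _ (Finset.mem_univ j),
    ← Finset.mul_prod_erase _ (fun l => (α l).factorial) (Finset.mem_univ j), ← mul_assoc]
  congr 1
  · simp [Nat.factorial_succ]
  · refine Finset.prod_congr rfl fun l hl => ?_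
    simp [(Finset.ne_of_mem_erase hl).symm]

lemma apolarPairing_X_mul (j : Fin m) (F f : MvPolynomial (Fin m) A) :
    apolarPairing A m (X j * F) f = apolarPairing A m F (pderiv j f) := by
  induction F using MvPolynomial.induction_on' with
  | add p q hp hq => simp only [mul_add, map_add, LinearMap.add_apply, hp, hq]
  | monomial α c =>
    have hfactorial : ∏ l, (((α + Finsupp.single j 1 : Fin m →₀ ℕ) l).factorial : A) =
        (α j + 1) * ∏ l, ((α l).factorial : A) := by
      exact_mod_cast congrArg (Nat.cast : ℕ → A) (prod_factorial_add_single α j)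
    rw [← mul_one c, ← smul_eq_mul c, ← smul_monomial, mul_smul_comm, map_smul, map_smul,
      LinearMap.smul_apply, LinearMap.smul_apply, X, monomial_mul, one_mul,
      add_comm (Finsupp.single j 1), apolarPairing_monomial_left, apolarPairing_monomial_left,
      coeff_pderiv, hfactorial]
    ring_nf

lemma apolarPairing_X_pow_mul (j : Fin m) (e : ℕ) (F f : MvPolynomial (Fin m) A) :
    apolarPairing A m (X j ^ e * F) f =
      apolarPairing A m F
        ((((pderiv j).toLinearMap : Module.End A (MvPolynomial (Fin m) A)) ^ e) f) := by
  induction e generalizing f with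
  | zero => rw [pow_zero, one_mul, pow_zero, Module.End.one_apply]
  | succ e ih =>
    rw [pow_succ', mul_assoc, apolarPairing_X_mul, ih, pow_succ, Module.End.mul_apply]
    rfl

lemma monomial_one_eq_prod_finRange (α : Fin m →₀ ℕ) :
    (monomial α 1 : MvPolynomial (Fin m) A) =
      ((List.finRange m).map fun j => X j ^ α j).prod := by
  rw [← Fin.prod_univ_def, monomial_eq, C_1, one_mul, Finsupp.prod_fintype _ _ (by simp)]

lemma degree_eq_sum_finRange (α : Fin m →₀ ℕ) : α.degree = ((List.finRange m).map α).sum := by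
  rw [← Fin.sum_univ_def, Finsupp.degree_eq_sum]

lemma apolarPairing_monomial_mul (α : Fin m →₀ ℕ) (F f : MvPolynomial (Fin m) A) :
    apolarPairing A m (monomial α 1 * F) f = apolarPairing A m F (partialDeriv α f) := by
  rw [monomial_one_eq_prod_finRange, partialDeriv]
  induction List.finRange m generalizing F with
  | nil => rw [List.map_nil, List.map_nil, List.prod_nil, List.prod_nil, one_mul,
      Module.End.one_apply]
  | cons j l ih =>
    rw [List.map_cons, List.prod_cons, mul_assoc, mul_left_comm, ih, apolarPairing_X_pow_mul,
      List.map_cons, List.prod_cons, Module.End.mul_apply]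

lemma isHomogeneous_pderiv_pow {t : ℕ} (j : Fin m) (e : ℕ) {f : MvPolynomial (Fin m) A}
    (hf : f.IsHomogeneous t) :
    ((((pderiv j).toLinearMap : Module.End A (MvPolynomial (Fin m) A)) ^ e) f).IsHomogeneous
      (t - e) := by
  induction e with
  | zero => exact hf
  | succ e ih =>
    rw [pow_succ', Module.End.mul_apply, ← Nat.sub_sub]
    exact ih.pderiv

lemma isHomogeneous_partialDeriv {t : ℕ} (α : Fin m →₀ ℕ) {f : MvPolynomial (Fin m) A}
    (hf : f.IsHomogeneous t) : (partialDeriv α f).IsHomogeneous (t - α.degree) := by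
  rw [degree_eq_sum_finRange, partialDeriv]
  induction List.finRange m with
  | nil => exact hf
  | cons j l ih =>
    rw [List.map_cons, List.prod_cons, Module.End.mul_apply, List.map_cons, List.sum_cons,
      add_comm (α j), ← Nat.sub_sub]
    exact isHomogeneous_pderiv_pow j (α j) ih

lemma apolarPairing_linear_pow {t : ℕ} (a : Fin m → A) {g : MvPolynomial (Fin m) A}
    (hg : g.IsHomogeneous t) :
    apolarPairing A m ((∑ j, C (a j) * X j) ^ t) g = t.factorial * eval a g := by
  induction t generalizing g with
  | zero =>
    rw [← totalDegree_zero_iff_isHomogeneous, totalDegree_eq_zero_iff_eq_C] at hg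
    rw [hg, pow_zero, ← C_1, ← monomial_zero', apolarPairing_monomial_left]
    simp
  | succ t ih =>
    have hEuler : ∑ j, a j * eval a (pderiv j g) = (t + 1) * eval a g := by
      simpa using congrArg (eval a) hg.sum_X_mul_pderiv
    calc apolarPairing A m ((∑ j, C (a j) * X j) ^ (t + 1)) g
        = ∑ j, a j * apolarPairing A m ((∑ j, C (a j) * X j) ^ t) (pderiv j g) := by
          rw [pow_succ', Finset.sum_mul, map_sum, LinearMap.sum_apply]
          refine Finset.sum_congr rfl fun j _ => ?_
          rw [mul_assoc, ← smul_eq_C_mul, map_smul, LinearMap.smul_apply, apolarPairing_X_mul,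
            smul_eq_mul]
      _ = t.factorial * ∑ j, a j * eval a (pderiv j g) := by
          rw [Finset.mul_sum]
          exact Finset.sum_congr rfl fun j _ => by rw [ih hg.pderiv, mul_left_comm]
      _ = (t + 1).factorial * eval a g := by
          rw [hEuler, Nat.factorial_succ]
          push_cast
          ring

lemma apolarPairing_linear_pow_mul_monomial {t : ℕ} (a : Fin m → A) (β : Fin m →₀ ℕ)
    {f : MvPolynomial (Fin m) A} (hf : f.IsHomogeneous t) :
    apolarPairing A m ((∑ j, C (a j) * X j) ^ (t - β.degree) * monomial β 1) f =
      (t - β.degree).factorial * eval a (partialDeriv β f) := by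
  rw [mul_comm, apolarPairing_monomial_mul,
    apolarPairing_linear_pow a (isHomogeneous_partialDeriv β hf)]

lemma nondegenerate_apolarPairing [NoZeroDivisors A] [CharZero A] (t : ℕ) :
    ((apolarPairing A m).domRestrict₁₂ (homogeneousSubmodule (Fin m) A t)
      (homogeneousSubmodule (Fin m) A t)).Nondegenerate := by
  have hmonomial {α : Fin m →₀ ℕ} (hα : α.degree = t) :
      monomial α (1 : A) ∈ homogeneousSubmodule (Fin m) A t := isHomogeneous_monomial _ hα
  have hfactorial (α : Fin m →₀ ℕ) : (∏ j, (α j).factorial : A) ≠ 0 := by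
    exact_mod_cast Finset.prod_ne_zero_iff.2 fun j _ => Nat.factorial_ne_zero _
  refine ⟨fun F hF => ?_, fun f hf => ?_⟩ <;> ext α <;> by_cases hα : α.degree = t
  · have h := hF ⟨_, hmonomial hα⟩
    rw [LinearMap.domRestrict₁₂_apply, apolarPairing_monomial_right] at h
    exact (mul_eq_zero.1 h).resolve_left (hfactorial α)
  · exact IsHomogeneous.coeff_eq_zero F.2 hα
  · have h := hf ⟨_, hmonomial hα⟩
    rw [LinearMap.domRestrict₁₂_apply, apolarPairing_monomial_left] at h
    exact (mul_eq_zero.1 h).resolve_left (hfactorial α)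
  · exact IsHomogeneous.coeff_eq_zero f.2 hα

end Apolarity

section SingularForms

variable {n t : ℕ} {I : Ideal (MvPolynomial (Fin (n + 1)) ℂ)}

lemma partialDeriv_eq_C_apolarPairing {f : MvPolynomial (Fin (n + 1)) ℂ}
    (hf : f.IsHomogeneous t) {α : Fin (n + 1) →₀ ℕ} (hα : α.degree = t) :
    partialDeriv α f = C (apolarPairing ℂ (n + 1) (monomial α 1) f) := by
  have hconst := isHomogeneous_partialDeriv α hf
  have hpair := apolarPairing_linear_pow_mul_monomial 0 α hf
  rw [hα, Nat.sub_self] at hconst hpair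
  rw [← totalDegree_zero_iff_isHomogeneous, totalDegree_eq_zero_iff_eq_C] at hconst
  rw [pow_zero, one_mul, Nat.factorial_zero, Nat.cast_one, one_mul, hconst, eval_C] at hpair
  rw [hpair, ← hconst]

lemma diffOp_eq_C_apolarPairing {F f : MvPolynomial (Fin (n + 1)) ℂ} (hF : F.IsHomogeneous t)
    (hf : f.IsHomogeneous t) : diffOp F f = C (apolarPairing ℂ (n + 1) F f) := by
  calc diffOp F f
      = ∑ α ∈ F.support, coeff α F • C (apolarPairing ℂ (n + 1) (monomial α 1) f) := by
        refine Finset.sum_congr rfl fun α hα => ?_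
        rw [partialDeriv_eq_C_apolarPairing hf (hF.degree_eq_sum_deg_support hα).symm]
    _ = C (apolarPairing ℂ (n + 1) (∑ α ∈ F.support, coeff α F • monomial α 1) f) := by
        simp only [map_sum, LinearMap.sum_apply, map_smul, LinearMap.smul_apply]
        simp only [smul_eq_C_mul, smul_eq_mul, C_mul]
    _ = C (apolarPairing ℂ (n + 1) F f) := by
        simp only [smul_monomial, smul_eq_mul, mul_one, support_sum_monomial_coeff]

lemma apolarForms_eq_inf_orthogonalBilin :
    apolarForms I t = forms n t ⊓ (idealPiece I t).orthogonalBilin (apolarPairing ℂ (n + 1)) := by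
  ext f
  refine and_congr_right fun hf => forall₂_congr fun F hF => ?_
  rw [diffOp_eq_C_apolarPairing hF.2 hf, map_eq_zero_iff _ (C_injective _ _)]

lemma formMultiples_eq_span (P : MvPolynomial (Fin (n + 1)) ℂ) (s : ℕ) :
    formMultiples P s =
      Submodule.span ℂ ((fun β => P * monomial β 1) '' {β : Fin (n + 1) →₀ ℕ | β.degree = s}) := by
  change (homogeneousSubmodule (Fin (n + 1)) ℂ s).map _ = _
  rw [homogeneousSubmodule_eq_finsupp_supported, ← restrictSupport, restrictSupport_eq_span,
    Submodule.map_span, Set.image_image]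
  rfl

lemma forms_inf_multiplicityAtLeast {k : ℕ} {s : ℤ} (hs : s + k = t) (a : Fin (n + 1) → ℂ) :
    forms n t ⊓ multiplicityAtLeast (s + 1) a =
      forms n t ⊓ (formMultiples (linForm a ^ k) s).orthogonalBilin (apolarPairing ℂ (n + 1)) := by
  ext f
  refine and_congr_right fun hf => ?_
  have hpair (β : Fin (n + 1) →₀ ℕ) := apolarPairing_linear_pow_mul_monomial a β hf
  simp_rw [← linForm.eq_1 a] at hpair
  constructor
  · intro h
    rcases lt_or_ge s 0 with hs₀ | hs₀
    · rintro _ ⟨G, hG, rfl⟩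
      rw [forms_of_neg hs₀] at hG
      obtain rfl : G = 0 := hG
      simp
    lift s to ℕ using hs₀
    have hspan : formMultiples (linForm a ^ k) s ≤
        LinearMap.ker ((apolarPairing ℂ (n + 1)).flip f) := by
      rw [formMultiples_eq_span, Submodule.span_le]
      rintro _ ⟨β, rfl : β.degree = s, rfl⟩
      obtain rfl : k = t - β.degree := by omega
      exact (hpair β).trans (by rw [h β (by omega), mul_zero])
    exact hspan
  · intro h α hα
    lift s to ℕ using (by omega)
    have hle : α.degree ≤ s := by omega
    have hmem : linForm a ^ (s - α.degree) * monomial α 1 ∈ forms n s := by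
      have hhom := (isHomogeneous_linForm_pow a (s - α.degree)).mul
        (isHomogeneous_monomial (1 : ℂ) (rfl : α.degree = α.degree))
      rwa [Nat.sub_add_cancel hle] at hhom
    have hzero := h _ ⟨_, hmem, rfl⟩
    rw [LinearMap.mulLeft_apply, ← mul_assoc, ← pow_add,
      show k + (s - α.degree) = t - α.degree by omega, hpair, mul_eq_zero] at hzero
    exact hzero.resolve_left (Nat.cast_ne_zero.2 (Nat.factorial_ne_zero _))

lemma finrank_apolarForms_inf_multiplicityAtLeast {k : ℕ} {s : ℤ} (hs : s + k = t)
    {a : Fin (n + 1) → ℂ} (ha : a ≠ 0) :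
    Module.finrank ℂ ↥(apolarForms I t ⊓ multiplicityAtLeast (s + 1) a) +
      mulRank I (linForm a ^ k) s = Module.finrank ℂ (quotPiece I t) := by
  have hP := isHomogeneous_linForm_pow a k
  have hle : formMultiples (linForm a ^ k) s ⊔ idealPiece I t ≤ forms n t :=
    sup_le (hs ▸ formMultiples_le s hP) inf_le_right
  have horth : apolarForms I t ⊓ multiplicityAtLeast (s + 1) a =
      forms n t ⊓ (formMultiples (linForm a ^ k) s ⊔ idealPiece I t).orthogonalBilin
        (apolarPairing ℂ (n + 1)) := by
    rw [sup_orthogonalBilin, ← inf_assoc, ← forms_inf_multiplicityAtLeast hs, inf_right_comm,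
      ← apolarForms_eq_inf_orthogonalBilin]
  have hfinrank := finrank_inf_orthogonalBilin_add_finrank
    (H := forms n t) (nondegenerate_apolarPairing t) hle
  rw [← horth] at hfinrank
  have hsup := Submodule.finrank_sup_add_finrank_inf_eq (formMultiples (linForm a ^ k) s)
    (idealPiece I t)
  rw [finrank_formMultiples s (pow_ne_zero k (linForm_ne_zero ha))] at hsup
  have hmul := mulRank_add_finrank_formMultiples_inf (I := I) s hP
    (pow_ne_zero k (linForm_ne_zero ha))
  rw [hs] at hmul
  have hA := finrank_quotPiece_add_finrank_idealPiece I t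
  omega

end SingularForms

/-! ### Osculating spaces of the projected Veronese variety -/

section Osculating

lemma pderiv_pow_linear_pow {A : Type*} [CommRing A] {m : ℕ} {φ : MvPolynomial (Fin m) A}
    {j : Fin m} {b : A} (hφ : pderiv j φ = C b) (c : A) (u e : ℕ) :
    (((pderiv j).toLinearMap : Module.End A (MvPolynomial (Fin m) A)) ^ e) (C c * φ ^ u) =
      C (b ^ e * c * u.descFactorial e) * φ ^ (u - e) := by
  induction e with
  | zero => simp
  | succ e ih =>
    rw [pow_succ', Module.End.mul_apply, ih]
    change pderiv j _ = _
    rw [pderiv_C_mul, pderiv_pow, hφ, Nat.descFactorial_succ, Nat.sub_sub, ← map_natCast C]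
    push_cast
    simp only [C_mul, C_pow]
    ring

lemma partialDeriv_linear_pow {A : Type*} [CommRing A] {m : ℕ} {φ : MvPolynomial (Fin m) A}
    {b : Fin m → A} (hφ : ∀ j, pderiv j φ = C (b j)) (t : ℕ) (α : Fin m →₀ ℕ) :
    partialDeriv α (φ ^ t) =
      C ((∏ j, b j ^ α j) * t.descFactorial α.degree) * φ ^ (t - α.degree) := by
  rw [degree_eq_sum_finRange, Fin.prod_univ_def, partialDeriv]
  induction List.finRange m with
  | nil => simp
  | cons j l ih =>
    rw [List.map_cons, List.prod_cons, Module.End.mul_apply, ih, pderiv_pow_linear_pow (hφ j),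
      List.map_cons, List.map_cons, List.prod_cons, List.sum_cons, Nat.sub_sub,
      Nat.add_comm (α j)]
    congr 2
    rw [← Nat.descFactorial_mul_descFactorial (Nat.le_add_right (l.map α).sum (α j)),
      Nat.add_sub_cancel_left]
    push_cast
    ring

variable {n : ℕ} (I : Ideal (MvPolynomial (Fin (n + 1)) ℂ)) (y : Fin n → ℂ)

lemma linForm_cons_one : linForm (Fin.cons 1 y : Fin (n + 1) → ℂ) =
    X 0 + ∑ j : Fin n, C (y j) * X j.succ := by
  simp [linForm, Fin.sum_univ_succ]

lemma projVeroneseParam_eq_pow (t : ℕ) : projVeroneseParam I t =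
    (C (Ideal.Quotient.mk I (X 0)) + ∑ j, C (Ideal.Quotient.mk I (X j.succ)) * X j) ^ t := by
  simp [projVeroneseParam, veroneseParam]

lemma eval_partialDeriv_projVeroneseParam (t : ℕ) (α : Fin n →₀ ℕ) :
    eval (fun j => algebraMap ℂ (MvPolynomial (Fin (n + 1)) ℂ ⧸ I) (y j))
      (partialDeriv α (projVeroneseParam I t)) =
    (t.descFactorial α.degree : ℂ) • Ideal.Quotient.mkₐ ℂ I
      (linForm (Fin.cons 1 y) ^ (t - α.degree) * ∏ j : Fin n, X j.succ ^ α j) := by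
  have hderiv (j : Fin n) : pderiv j (C (Ideal.Quotient.mk I (X 0)) +
      ∑ l, C (Ideal.Quotient.mk I (X l.succ)) * X l) = C (Ideal.Quotient.mk I (X j.succ)) := by
    simp [pderiv_X, Pi.single_apply]
  have hlinForm : eval (fun j => algebraMap ℂ (MvPolynomial (Fin (n + 1)) ℂ ⧸ I) (y j))
      (C (Ideal.Quotient.mk I (X 0)) + ∑ j, C (Ideal.Quotient.mk I (X j.succ)) * X j) =
        Ideal.Quotient.mk I (linForm (Fin.cons 1 y)) := by
    rw [linForm_cons_one, map_add, eval_C, map_sum, map_add, map_sum]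
    congr 1
    refine Finset.sum_congr rfl fun j _ => ?_
    rw [map_mul, eval_C, eval_X, map_mul, mul_comm]
    rfl
  rw [projVeroneseParam_eq_pow, partialDeriv_linear_pow hderiv, map_mul, eval_C, map_pow, hlinForm,
    Nat.cast_smul_eq_nsmul, nsmul_eq_mul, map_mul, map_pow, map_prod]
  simp only [map_pow, Ideal.Quotient.mkₐ_eq_mk]
  ring

lemma span_range_cons_linForm :
    Submodule.span ℂ (Set.range (Fin.cons (linForm (Fin.cons 1 y)) fun j : Fin n => X j.succ :
      Fin (n + 1) → MvPolynomial (Fin (n + 1)) ℂ)) = homogeneousSubmodule (Fin (n + 1)) ℂ 1 := by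
  rw [homogeneousSubmodule_one_eq_span_X]
  apply le_antisymm <;> rw [Submodule.span_le] <;> rintro _ ⟨j, rfl⟩
  · cases j using Fin.cases with
    | zero =>
      rw [SetLike.mem_coe, ← homogeneousSubmodule_one_eq_span_X]
      exact isHomogeneous_linForm _
    | succ j => exact Submodule.subset_span ⟨j.succ, rfl⟩
  · cases j using Fin.cases with
    | zero =>
      rw [SetLike.mem_coe, eq_sub_of_add_eq (linForm_cons_one y).symm]
      refine Submodule.sub_mem _ (Submodule.subset_span ⟨0, rfl⟩)
        (Submodule.sum_mem _ fun j _ => ?_)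
      rw [← smul_eq_C_mul]
      exact Submodule.smul_mem _ _ (Submodule.subset_span ⟨j.succ, rfl⟩)
    | succ j => exact Submodule.subset_span ⟨j.succ, rfl⟩

lemma forms_eq_span (s : ℕ) :
    forms n s = Submodule.span ℂ ((fun α : Fin n →₀ ℕ =>
      linForm (Fin.cons 1 y) ^ (s - α.degree) * ∏ j : Fin n, X j.succ ^ α j) ''
        {α | α.degree ≤ s}) := by
  have hpow := span_range_pow_eq_span (K := ℂ) (Fin.cons (linForm (Fin.cons 1 y))
    fun j : Fin n => X j.succ : Fin (n + 1) → MvPolynomial (Fin (n + 1)) ℂ) s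
  rw [span_range_cons_linForm, homogeneousSubmodule_one_pow] at hpow
  exact hpow

lemma osculatingSpace_projVeroneseParam {k t : ℕ} {s : ℤ} (hs : s + k = t) :
    osculatingSpace (projVeroneseParam I t) s y = mulImage I (linForm (Fin.cons 1 y) ^ k) s := by
  rcases lt_or_ge s 0 with hs₀ | hs₀
  · rw [mulImage, quotPiece, forms_of_neg hs₀, Submodule.map_bot, Submodule.map_bot,
      osculatingSpace, Submodule.span_eq_bot]
    rintro _ ⟨α, hα, -⟩
    omega
  lift s to ℕ using hs₀
  have hderiv (α : Fin n →₀ ℕ) (hα : α.degree ≤ s) :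
      eval (fun j => algebraMap ℂ (MvPolynomial (Fin (n + 1)) ℂ ⧸ I) (y j))
        (partialDeriv α (projVeroneseParam I t)) =
      (t.descFactorial α.degree : ℂ) • Ideal.Quotient.mkₐ ℂ I (linForm (Fin.cons 1 y) ^ k *
        (linForm (Fin.cons 1 y) ^ (s - α.degree) * ∏ j : Fin n, X j.succ ^ α j)) := by
    rw [eval_partialDeriv_projVeroneseParam, ← mul_assoc, ← pow_add,
      show t - α.degree = k + (s - α.degree) by omega]
  rw [← map_mkₐ_formMultiples, formMultiples, forms_eq_span y s, Submodule.map_span,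
    Submodule.map_span, Set.image_image, Set.image_image]
  apply le_antisymm <;> rw [osculatingSpace, Submodule.span_le]
  · rintro _ ⟨α, hα, rfl⟩
    have hαs : α.degree ≤ s := by exact_mod_cast hα
    rw [hderiv α hαs]
    exact Submodule.smul_mem _ _ (Submodule.subset_span ⟨α, hαs, rfl⟩)
  · rintro _ ⟨α, hα : α.degree ≤ s, rfl⟩
    have hne : (t.descFactorial α.degree : ℂ) ≠ 0 := by
      rw [Nat.cast_ne_zero, Ne, Nat.descFactorial_eq_zero_iff_lt]
      omega
    rw [SetLike.mem_coe, ← Submodule.smul_mem_iff _ hne]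
    exact Submodule.subset_span ⟨α, by exact_mod_cast hα, (hderiv α hα).symm⟩

end Osculating

/-! ### The conditions in terms of the rank defect -/

section Conditions

variable {n r d i k : ℕ} {F : Fin r → MvPolynomial (Fin (n + 1)) ℂ}

lemma generalRank_add_rankDefect_sub (I : Ideal (MvPolynomial (Fin (n + 1)) ℂ)) (d i k : ℕ) :
    generalRank I k ((d : ℤ) + i - k) + rankDefect I k ((d : ℤ) + i - k) =
      min (Module.finrank ℂ (quotPiece I ((d : ℤ) + i - k)))
        (Module.finrank ℂ (quotPiece I ((d : ℤ) + i))) := by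
  rw [generalRank_add_rankDefect, sub_add_cancel]

lemma hasRelations_iff_le_rankDefect (hF : ∀ j, (F j).IsHomogeneous d) (hsyz : NoSyzygy F i)
    (k δ : ℕ) : HasRelations F d i k (numNPlus n r i k d + δ) ↔
      δ ≤ rankDefect (Ideal.span (Set.range F)) k ((d : ℤ) + i - k) := by
  have hgeneral := forGeneral_ne_zero.and
    (forGeneral_mulRank_eq_generalRank (Ideal.span (Set.range F)) k ((d : ℤ) + i - k))
  have hN := numN_eq hF hsyz k
  have hdefect := generalRank_add_rankDefect_sub (Ideal.span (Set.range F)) d i k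
  have hiff {a : Fin (n + 1) → ℂ} (ha : a ≠ 0) := exists_relations_iff hF hsyz
    (isHomogeneous_linForm_pow a k) (pow_ne_zero k (linForm_ne_zero ha)) (numNPlus n r i k d + δ)
  constructor
  · intro h
    obtain ⟨a, hrel, ha, hrank⟩ := (h.and hgeneral).exists
    have hcard := (hiff ha).1 hrel
    rw [hrank, numNPlus] at hcard
    omega
  · intro h
    refine hgeneral.mono fun a ⟨ha, hrank⟩ => (hiff ha).2 ?_
    rw [hrank, numNPlus]
    omega

lemma hasSingularForms_iff_le_rankDefect (hF : ∀ j, (F j).IsHomogeneous d) (hsyz : NoSyzygy F i)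
    (k δ : ℕ) : HasSingularForms (Ideal.span (Set.range F)) d i k (numNMinus n r i k d + δ) ↔
      δ ≤ rankDefect (Ideal.span (Set.range F)) k ((d : ℤ) + i - k) := by
  have hN := numN_eq hF hsyz k
  have hdefect := generalRank_add_rankDefect_sub (Ideal.span (Set.range F)) d i k
  have hsum {a : Fin (n + 1) → ℂ} (ha : a ≠ 0) :
      Module.finrank ℂ ↥(apolarForms (Ideal.span (Set.range F)) ((d : ℤ) + i) ⊓
          multiplicityAtLeast ((d : ℤ) + i - k + 1) a) +
        mulRank (Ideal.span (Set.range F)) (linForm a ^ k) ((d : ℤ) + i - k) =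
      Module.finrank ℂ (quotPiece (Ideal.span (Set.range F)) ((d : ℤ) + i)) := by
    exact_mod_cast finrank_apolarForms_inf_multiplicityAtLeast (t := d + i)
      (sub_add_cancel ((d : ℤ) + i) k) ha
  rw [numNMinus]
  constructor
  · intro h
    obtain ⟨a, ha, hrank⟩ := (forGeneral_ne_zero.and
      (forGeneral_mulRank_eq_generalRank (Ideal.span (Set.range F)) k ((d : ℤ) + i - k))).exists
    have hcard := h a ha
    have hsum_a := hsum ha
    omega
  · intro h a ha
    have hrank := mulRank_le_generalRank (Ideal.span (Set.range F)) k ((d : ℤ) + i - k) a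
    have hsum_a := hsum ha
    omega

lemma projectionSatisfiesLaplace_iff_eq_rankDefect (I : Ideal (MvPolynomial (Fin (n + 1)) ℂ))
    (d i k δ : ℕ) : ProjectionSatisfiesLaplace I d i k δ ↔
      δ = rankDefect I k ((d : ℤ) + i - k) := by
  have hgeneral := forGeneral_mulRank_cons_one_eq_generalRank I k ((d : ℤ) + i - k)
  have hdefect := generalRank_add_rankDefect_sub I d i k
  have hosc (y : Fin n → ℂ) :
      Module.finrank ℂ (osculatingSpace (projVeroneseParam I (d + i)) ((d : ℤ) + i - k) y) =
        mulRank I (linForm (Fin.cons 1 y) ^ k) ((d : ℤ) + i - k) := by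
    rw [osculatingSpace_projVeroneseParam (k := k) I y (by push_cast; ring), mulRank]
  have hdim := finrank_quotPiece_add_finrank_idealPiece I ((d : ℤ) + i - k)
  rw [finrank_forms] at hdim
  constructor
  · intro h
    obtain ⟨y, hlaplace, hrank⟩ := (h.and hgeneral).exists
    rw [hosc, hrank] at hlaplace
    omega
  · intro h
    refine hgeneral.mono fun y hrank => ?_
    rw [hosc, hrank]
    omega

lemma finrank_idealPiece_eq_zero_of_lt (hF : ∀ j, (F j).IsHomogeneous d) (hik : i < k) :
    Module.finrank ℂ (idealPiece (Ideal.span (Set.range F)) ((d : ℤ) + i - k)) = 0 := by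
  have hzero : formVectors n r ((i : ℤ) - k) = ⊥ := by
    rw [formVectors, forms_of_neg (by omega), Submodule.pi_univ_bot]
  rw [add_sub_assoc, ← map_combination_formVectors hF, hzero, Submodule.map_bot, finrank_bot]

end Conditions

theorem theorem5p1_general (n r d i k : ℕ)
    (F : Fin r → MvPolynomial (Fin (n + 1)) ℂ) (hF : ∀ j, (F j).IsHomogeneous d)
    (I : Ideal (MvPolynomial (Fin (n + 1)) ℂ)) (hI : I = Ideal.span (Set.range F))
    (hsyz : NoSyzygy F i) :
    List.TFAE
      [FailsSLPAt I k ((d : ℤ) + i - k),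
       ∃ δ : ℕ, 1 ≤ δ ∧ HasRelations F d i k (numNPlus n r i k d + δ),
       ∃ δ : ℕ, 1 ≤ δ ∧ ProjectionSatisfiesLaplace I d i k δ,
       ∃ δ : ℕ, 1 ≤ δ ∧ HasSingularForms I d i k (numNMinus n r i k d + δ)] ∧
    (∀ δ : ℕ,
      List.TFAE
        [HasRelations F d i k (numNPlus n r i k d + δ),
         ∃ δ' : ℕ, δ ≤ δ' ∧ ProjectionSatisfiesLaplace I d i k δ',
         HasSingularForms I d i k (numNMinus n r i k d + δ)]) ∧
    (i < k → ∀ δ : ℕ,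
      (ProjectionSatisfiesLaplace I d i k δ ↔
        SatisfiesLaplace (quotPiece I ((d : ℤ) + i)) (projVeroneseParam I (d + i))
          ((d : ℤ) + i - k) δ)) := by
  subst hI
  have hexists (ρ δ : ℕ) : (∃ δ', δ ≤ δ' ∧ δ' ≤ ρ) ↔ δ ≤ ρ :=
    ⟨fun ⟨_, h, h'⟩ => h.trans h', fun h => ⟨δ, le_rfl, h⟩⟩
  refine ⟨?_, fun δ => ?_, fun hik δ => ?_⟩
  · simp only [failsSLPAt_iff_one_le_rankDefect, hasRelations_iff_le_rankDefect hF hsyz,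
      projectionSatisfiesLaplace_iff_eq_rankDefect, hasSingularForms_iff_le_rankDefect hF hsyz,
      hexists, exists_eq_right]
    tfae_finish
  · simp only [hasRelations_iff_le_rankDefect hF hsyz, exists_eq_right,
      projectionSatisfiesLaplace_iff_eq_rankDefect, hasSingularForms_iff_le_rankDefect hF hsyz]
    tfae_finish
  · rw [ProjectionSatisfiesLaplace, finrank_idealPiece_eq_zero_of_lt hF hik, SatisfiesLaplace]

theorem theorem5p1 (n r d i k : ℕ) (hk : 1 ≤ k)
    (F : Fin r → MvPolynomial (Fin (n + 1)) ℂ) (hF : ∀ j, (F j).IsHomogeneous d)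
    (I : Ideal (MvPolynomial (Fin (n + 1)) ℂ)) (hI : I = Ideal.span (Set.range F))
    (hart : IsArtinianRing (MvPolynomial (Fin (n + 1)) ℂ ⧸ I))
    (hsyz : NoSyzygy F i) :
    List.TFAE
      [FailsSLPAt I k ((d : ℤ) + i - k),
       ∃ δ : ℕ, 1 ≤ δ ∧ HasRelations F d i k (numNPlus n r i k d + δ),
       ∃ δ : ℕ, 1 ≤ δ ∧ ProjectionSatisfiesLaplace I d i k δ,
       ∃ δ : ℕ, 1 ≤ δ ∧ HasSingularForms I d i k (numNMinus n r i k d + δ)] ∧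
    (∀ δ : ℕ, 1 ≤ δ →
      List.TFAE
        [HasRelations F d i k (numNPlus n r i k d + δ),
         ∃ δ' : ℕ, δ ≤ δ' ∧ ProjectionSatisfiesLaplace I d i k δ',
         HasSingularForms I d i k (numNMinus n r i k d + δ)]) ∧
    (i < k → ∀ δ : ℕ,
      (ProjectionSatisfiesLaplace I d i k δ ↔
        SatisfiesLaplace (quotPiece I ((d : ℤ) + i)) (projVeroneseParam I (d + i))
          ((d : ℤ) + i - k) δ)) := by
  obtain ⟨hfails, hdelta, hlaplace⟩ := theorem5p1_general n r d i k F hF I hI hsyz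
  exact ⟨hfails, fun δ _ => hdelta δ, hlaplace⟩
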